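/- Let $f:\mathbb R\to\mathbb R\cup\{\infty\}$ be measurable and let $c>0$ be such that $Z_c=\int_{\mathbb R} e^{-cf(x)}\,dx\in(0,\infty)$. For $n\ge 1$ let $X=(X_1,\dots,X_n)$ have the Gibbs density $$g_{n,c}(x)=Z_c^{-n}\exp\Big(-c\sum_{i=1}^n f(x_i)\Big),\qquad x\in\mathbb R^n,$$ so that the variables $Y_j=f(X_j)$ are independent and identically distributed, with a law that does not depend on $n$. Let $\mu=\mathbb E Y_j$ and $\phi(u)=\mathbb E e^{iuY_j}$, and assume that $\mathbb E|Y_j-\mu|^3<\infty$. Then there is a constant $C>0$, depending only on the law of $Y_j$, such that the following holds for every real $r\ge1$ with $\int_{\mathbb R}|\phi(u)|^r\,du<\infty$. For every integer $j\ge r$ the sum $Y_1+\dots+Y_j$ has a unique continuous density $w_j$ on $\mathbb R$; and for all integers $n,k\ge0$ with $n-k\ge r$ and $\sqrt n>C$ one has $w_n(n\mu)>0$ and $$\log\frac{w_{n-k}(z)}{w_n(n\mu)}\;\le\;\log\frac{n}{n-k}+\frac{2}{\sqrt n/C-1}\qquad\text{for all } z\in\mathbb R$$ (with $\log 0=-\infty$).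 -/

import Mathlib

open MeasureTheory
open scoped ENNReal

noncomputable section

/-- The partition function `Z_c = ∫ exp (-c f(x)) dx`; here `f` takes values in `ℝ ∪ {∞}` (as
elements of `EReal` other than `⊥`) and `exp (-∞) = 0`. -/
def partitionFunction (f : ℝ → EReal) (c : ℝ) : ℝ≥0∞ :=
  ∫⁻ x : ℝ, EReal.exp (-((c : EReal) * f x))

/-- `R_n(x) = ∑ i, f (x i)`. -/
def hamiltonian (f : ℝ → EReal) (n : ℕ) (x : Fin n → ℝ) : EReal :=
  ∑ i, f (x i)

/-- The Gibbs density `g_{n,c}(x) = exp (-c R_n(x)) / Z_c ^ n` on `ℝⁿ`. -/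
def gibbsDensity (f : ℝ → EReal) (c : ℝ) (n : ℕ) (x : Fin n → ℝ) : ℝ≥0∞ :=
  EReal.exp (-((c : EReal) * hamiltonian f n x)) / partitionFunction f c ^ n

/-- The Gibbs distribution on `ℝⁿ`. -/
def gibbsMeasure (f : ℝ → EReal) (c : ℝ) (n : ℕ) : Measure (Fin n → ℝ) :=
  volume.withDensity (gibbsDensity f c n)

/-- The law of `R_n(X) = f(X_1) + ⋯ + f(X_n)` when `X` has density `g_{n,c}`. (The Gibbs
distribution gives no mass to the points where `R_n = ∞`, so that passing to real values by
`EReal.toReal` loses nothing.) -/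
def energyLaw (f : ℝ → EReal) (c : ℝ) (n : ℕ) : Measure ℝ :=
  (gibbsMeasure f c n).map fun x => (hamiltonian f n x).toReal

/-- The law of a single `Y_j = f(X_j)`, where `X_j` has density `g_{1,c}`. -/
def siteLaw (f : ℝ → EReal) (c : ℝ) : Measure ℝ :=
  energyLaw f c 1

/-- The mean `μ` of `Y_j`. -/
def siteMean (f : ℝ → EReal) (c : ℝ) : ℝ :=
  ∫ y, y ∂(siteLaw f c)

/-- `w` is a continuous probability density function, with respect to Lebesgue measure, of the
law `ν`. -/
structure IsContinuousDensity (ν : Measure ℝ) (w : ℝ → ℝ) : Prop where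
  continuous : Continuous w
  nonneg : ∀ x, 0 ≤ w x
  eq_withDensity : ν = volume.withDensity fun x => ENNReal.ofReal (w x)

end

/-! The Gibbs density is a product, so the total energy of `m` sites has characteristic function `φ
^ m`. Once this is integrable, Fourier inversion gives a continuous density with `2π w_m(z) ≤ ∫
|φ|^m` for every `z`. At `z = mμ` the phase cancels, and `2π w_m(mμ) = ∫ ψ^m`, where `ψ` is the
characteristic function of the centred law.

Both integrals are compared with the Gaussian integral `S / √m`, `S = √(2π / v)`, with `v` the
variance: the `L¹` distance from `ψ^m` to `exp (-v m u² / 2)` is at most `K / m`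
(`exists_integral_norm_charFun_pow_sub_gaussian_le`). Near `0` this is a third-order Taylor bound,
using the third moment; away from `0`, `|ψ| ≤ q < 1` makes the contribution of `ψ^m` exponentially
small (`exists_norm_charFun_le_of_density`).

With `C = K / S`, `exists_density_bounds` gives a uniform upper and a central lower bound, `S / √m`
times `1 ± C / √m`; their quotient is estimated in `log_density_ratio_le`. The constant does not
depend on `r`, because everything is built from the least `m₀ ≥ 1` with `|φ|^m₀` integrable, and
`|φ| ≤ 1` makes every `j ≥ r` at least `m₀`. -/

/-- The Gibbs density of a single site, as a real number. -/
noncomputable def siteWeight (f : ℝ → EReal) (c x : ℝ) : ℝ :=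
  (EReal.exp (-((c : EReal) * f x)) / partitionFunction f c).toReal

/-! ### Finite sums of extended reals. -/

theorem EReal.sum_ne_bot_of_forall {ι : Type*} (s : Finset ι) (g : ι → EReal)
    (h : ∀ i ∈ s, g i ≠ ⊥) : ∑ i ∈ s, g i ≠ ⊥ := by
  classical
  induction s using Finset.induction_on with
  | empty => simp
  | insert a s ha ih =>
    rw [Finset.sum_insert ha, Ne, EReal.add_eq_bot_iff, not_or]
    exact ⟨h a (by simp), ih fun i hi => h i (by simp [hi])⟩

theorem EReal.exp_neg_mul_sum {ι : Type*} (s : Finset ι) (g : ι → EReal) (c : ℝ) (hc : 0 < c)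
    (h : ∀ i ∈ s, g i ≠ ⊥) :
    EReal.exp (-((c : EReal) * ∑ i ∈ s, g i)) = ∏ i ∈ s, EReal.exp (-((c : EReal) * g i)) := by
  classical
  induction s using Finset.induction_on with
  | empty => simp
  | insert a s ha ih =>
    have h1 : g a ≠ ⊥ := h a (by simp)
    have h2 : ∑ i ∈ s, g i ≠ ⊥ :=
      EReal.sum_ne_bot_of_forall s g fun i hi => h i (by simp [hi])
    have hbot (y : EReal) (hy : y ≠ ⊥) : (c : EReal) * y ≠ ⊥ := by
      induction y with
      | bot => exact absurd rfl hy
      | top => rw [EReal.coe_mul_top_of_pos hc]; exact top_ne_bot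
      | coe y => rw [← EReal.coe_mul]; exact EReal.coe_ne_bot _
    rw [Finset.sum_insert ha, Finset.prod_insert ha, ← ih fun i hi => h i (by simp [hi]),
      EReal.left_distrib_of_nonneg_of_ne_top (by exact_mod_cast hc.le) (EReal.coe_ne_top _),
      ← EReal.exp_add, EReal.neg_add (Or.inl (hbot _ h1)) (Or.inr (hbot _ h2)), sub_eq_add_neg]

theorem EReal.toReal_finset_sum {ι : Type*} (s : Finset ι) (g : ι → EReal)
    (h : ∀ i ∈ s, g i ≠ ⊥) (h' : ∀ i ∈ s, g i ≠ ⊤) :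
    (∑ i ∈ s, g i).toReal = ∑ i ∈ s, (g i).toReal := by
  have : ∑ i ∈ s, g i = ((∑ i ∈ s, (g i).toReal : ℝ) : EReal) := by
    classical
    induction s using Finset.induction_on with
    | empty => simp
    | insert a s ha ih =>
      rw [Finset.sum_insert ha, Finset.sum_insert ha, EReal.coe_add,
        EReal.coe_toReal (h' a (by simp)) (h a (by simp)),
        ih (fun i hi => h i (by simp [hi])) (fun i hi => h' i (by simp [hi]))]
  rw [this, EReal.toReal_coe]

/-! ### The Gibbs measure as a product, and the characteristic function of the energy. -/

section Gibbs

variable {f : ℝ → EReal} {c : ℝ}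

theorem gibbsDensity_eq_prod (hf_bot : ∀ x, f x ≠ ⊥) (hc : 0 < c) (n : ℕ) (x : Fin n → ℝ) :
    gibbsDensity f c n x =
      ∏ i, EReal.exp (-((c : EReal) * f (x i))) / partitionFunction f c := by
  simp only [gibbsDensity, hamiltonian, ENNReal.div_eq_inv_mul]
  rw [EReal.exp_neg_mul_sum _ _ _ hc fun i _ => hf_bot _, Finset.prod_mul_distrib]
  simp [ENNReal.inv_pow]

theorem gibbsDensity_toReal (hf_bot : ∀ x, f x ≠ ⊥) (hc : 0 < c) (n : ℕ) (x : Fin n → ℝ) :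
    (gibbsDensity f c n x).toReal = ∏ i, siteWeight f c (x i) := by
  rw [gibbsDensity_eq_prod hf_bot hc, ENNReal.toReal_prod]
  rfl

theorem exp_neg_mul_lt_top (hf_bot : ∀ x, f x ≠ ⊥) (hc : 0 < c) (x : ℝ) :
    EReal.exp (-((c : EReal) * f x)) < ∞ := by
  have := hf_bot x
  rw [EReal.exp_lt_top_iff, lt_top_iff_ne_top, Ne, EReal.neg_eq_top_iff]
  generalize f x = y at *
  induction y with
  | bot => exact absurd rfl this
  | top => rw [EReal.coe_mul_top_of_pos hc]; exact top_ne_bot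
  | coe y => rw [← EReal.coe_mul]; exact EReal.coe_ne_bot _

theorem gibbsDensity_lt_top (hf_bot : ∀ x, f x ≠ ⊥) (hc : 0 < c)
    (hZ_pos : partitionFunction f c ≠ 0) (n : ℕ) (x : Fin n → ℝ) :
    gibbsDensity f c n x < ∞ := by
  rw [gibbsDensity_eq_prod hf_bot hc]
  exact ENNReal.prod_lt_top fun i _ =>
    ENNReal.div_lt_top (exp_neg_mul_lt_top hf_bot hc _).ne hZ_pos

theorem measurable_exp_neg_mul (hf : Measurable f) :
    Measurable fun x => EReal.exp (-((c : EReal) * f x)) :=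
  EReal.measurable_exp.comp ((hf.const_mul _).neg)

theorem measurable_hamiltonian (hf : Measurable f) (n : ℕ) : Measurable (hamiltonian f n) := by
  unfold hamiltonian
  exact Finset.measurable_sum _ fun i _ => hf.comp (measurable_pi_apply i)

theorem measurable_gibbsDensity (hf : Measurable f) (n : ℕ) :
    Measurable (gibbsDensity f c n) := by
  unfold gibbsDensity
  exact (EReal.measurable_exp.comp (((measurable_hamiltonian hf n).const_mul _).neg)).div_const _

theorem lintegral_siteDensity (hf : Measurable f)
    (hZ_pos : partitionFunction f c ≠ 0) (hZ_fin : partitionFunction f c ≠ ∞) :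
    ∫⁻ x, EReal.exp (-((c : EReal) * f x)) / partitionFunction f c = 1 := by
  simp only [div_eq_mul_inv]
  rw [lintegral_mul_const _ (measurable_exp_neg_mul hf)]
  exact ENNReal.mul_inv_cancel hZ_pos hZ_fin

theorem integrable_siteWeight (hf : Measurable f)
    (hZ_pos : partitionFunction f c ≠ 0) (hZ_fin : partitionFunction f c ≠ ∞) :
    Integrable (siteWeight f c) :=
  integrable_toReal_of_lintegral_ne_top ((measurable_exp_neg_mul hf).div_const _).aemeasurable
    (by rw [lintegral_siteDensity hf hZ_pos hZ_fin]; simp)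

theorem integral_siteWeight (hf : Measurable f) (hf_bot : ∀ x, f x ≠ ⊥) (hc : 0 < c)
    (hZ_pos : partitionFunction f c ≠ 0) (hZ_fin : partitionFunction f c ≠ ∞) :
    ∫ x, siteWeight f c x = 1 := by
  unfold siteWeight
  rw [integral_toReal ((measurable_exp_neg_mul hf).div_const _).aemeasurable
    (Filter.Eventually.of_forall fun x =>
      ENNReal.div_lt_top (exp_neg_mul_lt_top hf_bot hc _).ne hZ_pos),
    lintegral_siteDensity hf hZ_pos hZ_fin]
  simp

theorem isProbabilityMeasure_energyLaw (hf : Measurable f) (hf_bot : ∀ x, f x ≠ ⊥) (hc : 0 < c)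
    (hZ_pos : partitionFunction f c ≠ 0) (hZ_fin : partitionFunction f c ≠ ∞) (n : ℕ) :
    IsProbabilityMeasure (energyLaw f c n) := by
  have : IsProbabilityMeasure (gibbsMeasure f c n) := by
    constructor
    rw [gibbsMeasure, withDensity_apply _ MeasurableSet.univ, setLIntegral_univ]
    have h1 (x : Fin n → ℝ) :
        gibbsDensity f c n x = ENNReal.ofReal (∏ i, siteWeight f c (x i)) := by
      rw [← gibbsDensity_toReal hf_bot hc,
        ENNReal.ofReal_toReal (gibbsDensity_lt_top hf_bot hc hZ_pos n x).ne]
    have hinteg : Integrable (fun x : Fin n → ℝ => ∏ i, siteWeight f c (x i)) :=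
      Integrable.fintype_prod fun _ => integrable_siteWeight hf hZ_pos hZ_fin
    simp_rw [h1]
    rw [← ofReal_integral_eq_lintegral_ofReal hinteg
      (Filter.Eventually.of_forall fun x =>
        Finset.prod_nonneg fun i _ => ENNReal.toReal_nonneg),
      integral_fintype_prod_volume_eq_pow, integral_siteWeight hf hf_bot hc hZ_pos hZ_fin]
    simp
  exact Measure.isProbabilityMeasure_map (measurable_hamiltonian hf n).ereal_toReal.aemeasurable

theorem charFun_energyLaw (hf : Measurable f) (hf_bot : ∀ x, f x ≠ ⊥) (hc : 0 < c)
    (hZ_pos : partitionFunction f c ≠ 0) (n : ℕ) (u : ℝ) :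
    charFun (energyLaw f c n) u =
      (∫ x, (siteWeight f c x : ℂ) * Complex.exp (u * (f x).toReal * Complex.I)) ^ n := by
  rw [charFun_apply_real, energyLaw, integral_map
    (measurable_hamiltonian hf n).ereal_toReal.aemeasurable (by fun_prop), gibbsMeasure,
    integral_withDensity_eq_integral_toReal_smul (measurable_gibbsDensity hf n)
      (Filter.Eventually.of_forall fun x => gibbsDensity_lt_top hf_bot hc hZ_pos n x)]
  have key (x : Fin n → ℝ) : (gibbsDensity f c n x).toReal •
      Complex.exp (u * ((hamiltonian f n x).toReal : ℝ) * Complex.I) =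
      ∏ i, (siteWeight f c (x i) : ℂ) * Complex.exp (u * (f (x i)).toReal * Complex.I) := by
    rw [gibbsDensity_toReal hf_bot hc, Finset.prod_mul_distrib, Complex.real_smul,
      Complex.ofReal_prod]
    -- At an infinite energy `toReal` is not additive, but the weight of that site is `0`, so both
    -- sides vanish.
    by_cases h : ∃ i, f (x i) = ⊤
    · obtain ⟨i, hi⟩ := h
      have : siteWeight f c (x i) = 0 := by
        simp [siteWeight, hi, EReal.coe_mul_top_of_pos hc]
      rw [Finset.prod_eq_zero (Finset.mem_univ i) (by rw [this]; simp)]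
      simp
    · push Not at h
      rw [← Complex.exp_sum, hamiltonian,
        EReal.toReal_finset_sum _ _ (fun i _ => hf_bot _) (fun i _ => h i)]
      congr 2
      push_cast
      rw [Finset.mul_sum, Finset.sum_mul]
  simp_rw [key]
  rw [integral_fintype_prod_volume_eq_pow
    (fun y : ℝ => (siteWeight f c y : ℂ) * Complex.exp (u * (f y).toReal * Complex.I))]
  simp

/-- The characteristic function of the total energy is a power of that of a single site. -/
theorem charFun_energyLaw_eq_pow (hf : Measurable f) (hf_bot : ∀ x, f x ≠ ⊥) (hc : 0 < c)
    (hZ_pos : partitionFunction f c ≠ 0) (n : ℕ) (u : ℝ) :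
    charFun (energyLaw f c n) u = charFun (siteLaw f c) u ^ n := by
  rw [siteLaw, charFun_energyLaw hf hf_bot hc hZ_pos, charFun_energyLaw hf hf_bot hc hZ_pos,
    pow_one]

end Gibbs

/-! ### Fourier inversion for finite measures on the line. -/

section Inversion

open FourierTransform SchwartzMap Filter
open scoped ContDiff Topology

theorem charFun_neg_two_pi_mul (ν : Measure ℝ) (ξ : ℝ) :
    charFun ν (-(2 * Real.pi) * ξ) =
      VectorFourier.fourierIntegral Real.fourierChar ν (innerₗ ℝ) (1 : ℝ → ℂ) ξ := by
  rw [charFun_eq_fourierIntegral']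
  congr 1
  rw [smul_eq_mul, ← mul_assoc, neg_mul_neg, inv_mul_cancel₀ Real.two_pi_pos.ne', one_mul]

theorem integrable_charFun_neg_two_pi_mul {ν : Measure ℝ} (hφ : Integrable (charFun ν)) :
    Integrable fun ξ : ℝ => charFun ν (-(2 * Real.pi) * ξ) :=
  hφ.comp_mul_left' (neg_ne_zero.2 Real.two_pi_pos.ne')

/-- The Fourier transform is moved across the pairing twice: from `ν` onto `𝓕⁻ g`, which restores
`g`, and from `g` back onto the characteristic function. The sign in `-innerₗ ℝ` encodes the inverse
transform. -/
theorem integral_schwartz_eq_integral_fourierInv_charFun (ν : Measure ℝ) [IsFiniteMeasure ν]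
    (hφ : Integrable (charFun ν)) (g : 𝓢(ℝ, ℂ)) :
    ∫ y, g y ∂ν = ∫ x, 𝓕⁻ (fun ξ : ℝ => charFun ν (-(2 * Real.pi) * ξ)) x * g x := by
  have h1 := VectorFourier.integral_fourierIntegral_smul_eq_flip (μ := ν) (ν := volume)
    (L := innerₗ ℝ) (e := Real.fourierChar) (f := (1 : ℝ → ℂ)) (g := (𝓕⁻ g : 𝓢(ℝ, ℂ)))
    Real.continuous_fourierChar continuous_inner (integrable_const 1) (SchwartzMap.integrable _)
  have h2 := VectorFourier.integral_fourierIntegral_smul_eq_flip (μ := volume) (ν := volume)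
    (L := -innerₗ ℝ) (e := Real.fourierChar)
    (f := fun ξ : ℝ => charFun ν (-(2 * Real.pi) * ξ)) (g := g)
    Real.continuous_fourierChar continuous_inner.neg
    (integrable_charFun_neg_two_pi_mul hφ) g.integrable
  have h3 (y : ℝ) : VectorFourier.fourierIntegral Real.fourierChar volume (innerₗ ℝ).flip
      ((𝓕⁻ g : 𝓢(ℝ, ℂ)) : ℝ → ℂ) y = g y := by
    rw [flip_innerₗ]
    change (𝓕 ((𝓕⁻ g : 𝓢(ℝ, ℂ)) : ℝ → ℂ)) y = g y
    rw [← SchwartzMap.fourier_coe, FourierTransform.fourier_fourierInv_eq]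
  have h4 (x : ℝ) : VectorFourier.fourierIntegral Real.fourierChar volume (-innerₗ ℝ).flip
      g x = (𝓕⁻ g : 𝓢(ℝ, ℂ)) x := by
    have : (-innerₗ ℝ).flip = -innerₗ ℝ := by
      ext
      simp
    rw [this, SchwartzMap.fourierInv_coe]
    rfl
  simp only [h3, ← charFun_neg_two_pi_mul, Pi.one_apply, one_smul] at h1
  simp only [h4] at h2
  rw [← h1, ← h2]
  rfl

/-- The continuous function that is a density of `ν` when the characteristic function of `ν` is
integrable. -/
noncomputable def charFunDensity (ν : Measure ℝ) (x : ℝ) : ℝ :=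
  (𝓕⁻ (fun ξ : ℝ => charFun ν (-(2 * Real.pi) * ξ)) x).re

/-- Conjugating `charFun ν` reflects its argument, so its inverse transform is real. -/
theorem ofReal_charFunDensity (ν : Measure ℝ) (x : ℝ) :
    (charFunDensity ν x : ℂ) = 𝓕⁻ (fun ξ : ℝ => charFun ν (-(2 * Real.pi) * ξ)) x := by
  rw [charFunDensity, ← Complex.conj_eq_iff_re, Real.fourierInv_eq', ← integral_conj,
    ← integral_neg_eq_self]
  congr with ξ
  simp [← Complex.exp_conj, ← charFun_neg, Complex.conj_ofNat]

theorem continuous_charFunDensity {ν : Measure ℝ} (hφ : Integrable (charFun ν)) :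
    Continuous (charFunDensity ν) :=
  Complex.continuous_re.comp (VectorFourier.fourierIntegral_continuous
    Real.continuous_fourierChar continuous_inner.neg (integrable_charFun_neg_two_pi_mul hφ))

theorem integral_smooth_eq_integral_mul_charFunDensity (ν : Measure ℝ) [IsFiniteMeasure ν]
    (hφ : Integrable (charFun ν)) {g : ℝ → ℝ} (hg : ContDiff ℝ ∞ g) (hgc : HasCompactSupport g) :
    ∫ y, g y ∂ν = ∫ x, g x * charFunDensity ν x := by
  have hG : ContDiff ℝ ∞ fun x => (g x : ℂ) := Complex.ofRealCLM.contDiff.comp hg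
  have hGc : HasCompactSupport fun x => (g x : ℂ) := hgc.comp_left Complex.ofReal_zero
  have h := integral_schwartz_eq_integral_fourierInv_charFun ν hφ (hGc.toSchwartzMap hG)
  simp only [HasCompactSupport.toSchwartzMap_toFun, ← ofReal_charFunDensity,
    ← Complex.ofReal_mul] at h
  rw [integral_complex_ofReal, integral_complex_ofReal] at h
  rw [Complex.ofReal_injective h]
  simp only [mul_comm]

/-- A negative value would persist on a ball by continuity, and a bump supported there would have
negative integral against `ν`. -/
theorem charFunDensity_nonneg (ν : Measure ℝ) [IsFiniteMeasure ν]
    (hφ : Integrable (charFun ν)) (x : ℝ) : 0 ≤ charFunDensity ν x := by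
  by_contra! hx
  have hW := continuous_charFunDensity hφ
  obtain ⟨ε, hε, hball⟩ := Metric.eventually_nhds_iff_ball.1
    (hW.continuousAt.eventually_lt_const hx)
  let g : ContDiffBump x := ⟨ε / 2, ε, half_pos hε, half_lt_self hε⟩
  have h := integral_smooth_eq_integral_mul_charFunDensity ν hφ g.contDiff g.hasCompactSupport
  have h1 : 0 ≤ ∫ y, g y ∂ν := integral_nonneg fun y => g.nonneg
  have h2 : 0 < ∫ y, -(g y * charFunDensity ν y) := by
    refine Continuous.integral_pos_of_hasCompactSupport_nonneg_nonzero (x := x)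
      (g.continuous.mul hW).neg g.hasCompactSupport.mul_right.neg (fun y => ?_) ?_
    · by_cases hy : y ∈ Metric.ball x ε
      · simpa using mul_nonpos_of_nonneg_of_nonpos g.nonneg (hball y hy).le
      · rw [g.zero_of_le_dist (by simpa using hy)]
        simp
    · rw [g.one_of_mem_closedBall (by simpa using (half_pos hε).le)]
      simpa using hx.ne
  rw [integral_neg] at h2
  linarith

/-- Bumps equal to `1` on growing balls bound the integral over each ball by the total mass of `ν`.
-/
theorem integrable_charFunDensity (ν : Measure ℝ) [IsFiniteMeasure ν]
    (hφ : Integrable (charFun ν)) : Integrable (charFunDensity ν) := by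
  have hW := continuous_charFunDensity hφ
  have hcover : AECover (volume : Measure ℝ) atTop fun n : ℕ => Metric.closedBall (0 : ℝ) n := by
    refine ⟨Eventually.of_forall fun x => ?_, fun n => Metric.isClosed_closedBall.measurableSet⟩
    obtain ⟨N, hN⟩ := exists_nat_ge (dist x 0)
    filter_upwards [eventually_ge_atTop N] with n hn
    exact hN.trans (by exact_mod_cast hn)
  refine hcover.integrable_of_integral_bounded_of_nonneg_ae (ν.real Set.univ)
    (fun n => hW.continuousOn.integrableOn_compact (isCompact_closedBall _ _))
    (Eventually.of_forall (charFunDensity_nonneg ν hφ)) ?_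
  filter_upwards [eventually_gt_atTop 0] with n hn
  have hn' : (0 : ℝ) < n := by exact_mod_cast hn
  let g : ContDiffBump (0 : ℝ) := ⟨n, n + 1, hn', by simp⟩
  have h := integral_smooth_eq_integral_mul_charFunDensity ν hφ g.contDiff g.hasCompactSupport
  calc ∫ x in Metric.closedBall (0 : ℝ) n, charFunDensity ν x
      = ∫ x in Metric.closedBall (0 : ℝ) n, g x * charFunDensity ν x := by
        refine setIntegral_congr_fun Metric.isClosed_closedBall.measurableSet fun x hx => ?_
        simp only [g.one_of_mem_closedBall hx, one_mul]
    _ ≤ ∫ x, g x * charFunDensity ν x :=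
        setIntegral_le_integral
          ((g.continuous.mul hW).integrable_of_hasCompactSupport g.hasCompactSupport.mul_right)
          (Eventually.of_forall fun x => mul_nonneg g.nonneg (charFunDensity_nonneg ν hφ x))
    _ = ∫ y, g y ∂ν := h.symm
    _ ≤ ∫ y, 1 ∂ν :=
        integral_mono (g.continuous.integrable_of_hasCompactSupport g.hasCompactSupport)
          (integrable_const _) fun y => g.le_one
    _ = ν.real Set.univ := by simp

theorem charFun_withDensity_ofReal {w : ℝ → ℝ} (hw : Measurable w) (hw0 : ∀ x, 0 ≤ w x) (t : ℝ) :
    charFun (volume.withDensity fun x => ENNReal.ofReal (w x)) t =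
      ∫ x, (w x : ℂ) * Complex.exp (t * x * Complex.I) := by
  rw [charFun_apply_real, integral_withDensity_eq_integral_toReal_smul (by fun_prop) (by simp)]
  simp [ENNReal.toReal_ofReal (hw0 _)]

theorem charFun_withDensity_eq_fourier {w : ℝ → ℝ} (hw : Measurable w) (hw0 : ∀ x, 0 ≤ w x)
    (ξ : ℝ) :
    charFun (volume.withDensity fun x => ENNReal.ofReal (w x)) (-(2 * Real.pi) * ξ) =
      𝓕 (fun x : ℝ => (w x : ℂ)) ξ := by
  rw [charFun_withDensity_ofReal hw hw0, Real.fourier_real_eq_integral_exp_smul]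
  congr with x
  rw [smul_eq_mul, mul_comm]
  push_cast
  ring_nf

/-- A finite measure on `ℝ` with integrable characteristic function has a continuous density. -/
theorem isContinuousDensity_charFunDensity (ν : Measure ℝ) [IsFiniteMeasure ν]
    (hφ : Integrable (charFun ν)) : IsContinuousDensity ν (charFunDensity ν) := by
  have hW := continuous_charFunDensity hφ
  have hW0 := charFunDensity_nonneg ν hφ
  have hWi := integrable_charFunDensity ν hφ
  refine ⟨hW, hW0, ?_⟩
  have := isFiniteMeasure_withDensity_ofReal hWi.2
  refine Measure.ext_of_charFun (funext fun t => ?_)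
  obtain ⟨ξ, rfl⟩ : ∃ ξ, -(2 * Real.pi) * ξ = t :=
    ⟨(-(2 * Real.pi))⁻¹ * t, mul_inv_cancel_left₀ (neg_ne_zero.2 Real.two_pi_pos.ne') t⟩
  rw [charFun_withDensity_eq_fourier hW.measurable hW0]
  simp_rw [ofReal_charFunDensity]
  have hcont : Continuous fun ξ : ℝ => charFun ν (-(2 * Real.pi) * ξ) :=
    continuous_charFun.comp (continuous_const.mul continuous_id)
  have hF : Integrable (𝓕 fun ξ : ℝ => charFun ν (-(2 * Real.pi) * ξ)) := by
    have h := hWi.ofReal (𝕜 := ℂ) |>.comp_neg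
    refine h.congr (Eventually.of_forall fun x => ?_)
    refine (ofReal_charFunDensity ν (-x)).trans ?_
    rw [Real.fourierInv_eq_fourier_neg, neg_neg]
  exact (congrFun (hcont.fourier_fourierInv_eq (integrable_charFun_neg_two_pi_mul hφ) hF) ξ).symm

theorem IsContinuousDensity.unique {ν : Measure ℝ} {w w' : ℝ → ℝ} (h : IsContinuousDensity ν w)
    (h' : IsContinuousDensity ν w') : w = w' := by
  have h1 := h.eq_withDensity.symm.trans h'.eq_withDensity
  rw [withDensity_eq_iff_of_sigmaFinite h.continuous.measurable.ennreal_ofReal.aemeasurable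
    h'.continuous.measurable.ennreal_ofReal.aemeasurable] at h1
  refine (h.continuous.ae_eq_iff_eq volume h'.continuous).1 (h1.mono fun x hx => ?_)
  exact (ENNReal.ofReal_eq_ofReal_iff (h.nonneg x) (h'.nonneg x)).1 hx

theorem ofReal_charFunDensity_eq_integral (ν : Measure ℝ) (x : ℝ) :
    (charFunDensity ν x : ℂ) =
      (2 * Real.pi)⁻¹ * ∫ u : ℝ, Complex.exp (-(u * x * Complex.I)) * charFun ν u := by
  have h := Measure.integral_comp_mul_left
    (fun u : ℝ => Complex.exp (-(u * x * Complex.I)) * charFun ν u) (-(2 * Real.pi))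
  rw [ofReal_charFunDensity, Real.fourierInv_eq']
  rw [inv_neg, abs_neg, abs_of_pos (by positivity), Complex.real_smul] at h
  rw [← h]
  congr with ξ
  simp only [smul_eq_mul, RCLike.inner_apply, conj_trivial]
  push_cast
  ring_nf

end Inversion

/-! ### Taylor expansion and spectral gap of the characteristic function. -/

section LocalLimit

open Filter
open scoped Topology

theorem Complex.norm_exp_mul_I_sub_taylor_two_le (x : ℝ) :
    ‖Complex.exp (x * Complex.I) - (1 + x * Complex.I - (x : ℂ) ^ 2 / 2)‖ ≤ 4 * |x| ^ 3 := by
  have hnorm : ‖(x : ℂ) * Complex.I‖ = |x| := by simp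
  rcases le_total |x| 1 with hx | hx
  · have h := Complex.exp_bound (x := x * Complex.I) (by rwa [hnorm]) (n := 3) (by norm_num)
    rw [hnorm] at h
    have hs : ∑ m ∈ Finset.range 3, ((x : ℂ) * Complex.I) ^ m / (m.factorial : ℂ) =
        1 + x * Complex.I - (x : ℂ) ^ 2 / 2 := by
      simp [Finset.sum_range_succ, mul_pow, Nat.factorial]
      ring
    rw [hs] at h
    refine h.trans ?_
    have : 0 ≤ |x| ^ 3 := by positivity
    norm_num [Nat.factorial]
    linarith
  -- For `|x| ≥ 1` the four terms are bounded separately: `2 + |x| + |x|² / 2 ≤ 4 |x|³`.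
  · have h1 : ‖Complex.exp (x * Complex.I)‖ = 1 := Complex.norm_exp_ofReal_mul_I x
    have h2 : ‖(x : ℂ) ^ 2 / 2‖ = |x| ^ 2 / 2 := by simp
    calc _ ≤ ‖Complex.exp (x * Complex.I)‖ + (‖(1 : ℂ)‖ + ‖(x : ℂ) * Complex.I‖
          + ‖(x : ℂ) ^ 2 / 2‖) :=
          (norm_sub_le _ _).trans (add_le_add_right ((norm_sub_le _ _).trans
            (add_le_add_left (norm_add_le _ _) _)) _)
      _ = 1 + (1 + |x| + |x| ^ 2 / 2) := by rw [h1, h2, hnorm]; simp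
      _ ≤ 4 * |x| ^ 3 := by
          have h3 : |x| ≤ |x| ^ 3 := le_self_pow₀ hx (by norm_num)
          have h4 : |x| ^ 2 ≤ |x| ^ 3 := pow_le_pow_right₀ hx (by norm_num)
          linarith

theorem integrable_pow_of_integrable_abs_pow_three {μ : Measure ℝ} [IsFiniteMeasure μ]
    (h3 : Integrable (fun y : ℝ => |y| ^ 3) μ) {k : ℕ} (hk : k ≤ 3) :
    Integrable (fun y : ℝ => y ^ k) μ := by
  refine ((integrable_const 1).add h3).mono' (by fun_prop) (Eventually.of_forall fun y => ?_)
  rw [Real.norm_eq_abs, abs_pow, Pi.add_apply]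
  rcases le_total |y| 1 with hy | hy
  · have := pow_le_one₀ (n := k) (abs_nonneg y) hy
    have : 0 ≤ |y| ^ 3 := by positivity
    linarith
  · have := pow_le_pow_right₀ hy hk
    linarith

theorem norm_charFun_sub_taylor_two_le {μ : Measure ℝ} [IsProbabilityMeasure μ]
    (h3 : Integrable (fun y : ℝ => |y| ^ 3) μ) (h0 : ∫ y, y ∂μ = 0) (u : ℝ) :
    ‖charFun μ u - ((1 - (∫ y, y ^ 2 ∂μ) * u ^ 2 / 2 : ℝ) : ℂ)‖ ≤ 4 * (∫ y, |y| ^ 3 ∂μ) * |u| ^ 3 := by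
  have h1 : Integrable (fun y : ℝ => y) μ := by
    simpa using integrable_pow_of_integrable_abs_pow_three h3 (k := 1) (by norm_num)
  have h2 : Integrable (fun y : ℝ => y ^ 2) μ :=
    integrable_pow_of_integrable_abs_pow_three h3 (by norm_num)
  have hI1 : Integrable (fun y : ℝ => ((u * y : ℝ) : ℂ) * Complex.I) μ :=
    (h1.const_mul u).ofReal.mul_const _
  have hI2 : Integrable (fun y : ℝ => ((u * y : ℝ) : ℂ) ^ 2 / 2) μ := by
    have := ((h2.const_mul (u ^ 2)).ofReal (𝕜 := ℂ)).div_const 2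
    refine this.congr (Eventually.of_forall fun y => ?_)
    simp [mul_pow]
  have hI01 : Integrable (fun y : ℝ => 1 + ((u * y : ℝ) : ℂ) * Complex.I) μ :=
    (integrable_const _).add hI1
  have hE : Integrable (fun y : ℝ => Complex.exp ((u * y : ℝ) * Complex.I)) μ :=
    (integrable_const (1 : ℝ)).mono' (by fun_prop)
      (Eventually.of_forall fun y => (Complex.norm_exp_ofReal_mul_I _).le)
  have hT : ∫ y, (1 + ((u * y : ℝ) : ℂ) * Complex.I - ((u * y : ℝ) : ℂ) ^ 2 / 2) ∂μ =
      ((1 - (∫ y, y ^ 2 ∂μ) * u ^ 2 / 2 : ℝ) : ℂ) := by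
    rw [integral_sub hI01 hI2, integral_add (integrable_const _) hI1]
    have e1 : ∫ y, ((u * y : ℝ) : ℂ) * Complex.I ∂μ = 0 := by
      rw [integral_mul_const, integral_complex_ofReal, integral_const_mul, h0]
      simp
    have e2 : ∫ y, ((u * y : ℝ) : ℂ) ^ 2 / 2 ∂μ =
        (((∫ y, y ^ 2 ∂μ) * u ^ 2 / 2 : ℝ) : ℂ) := by
      rw [← integral_mul_const, ← integral_div, ← integral_complex_ofReal]
      congr with y
      push_cast
      ring
    rw [e1, e2]
    simp
  have hT' : Integrable
      (fun y : ℝ => 1 + ((u * y : ℝ) : ℂ) * Complex.I - ((u * y : ℝ) : ℂ) ^ 2 / 2) μ :=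
    hI01.sub hI2
  have hφ : charFun μ u = ∫ y, Complex.exp ((u * y : ℝ) * Complex.I) ∂μ := by
    rw [charFun_apply_real]
    simp
  rw [hφ, ← hT, ← integral_sub hE hT',
    ← integral_const_mul, ← integral_mul_const]
  refine norm_integral_le_of_norm_le ((h3.const_mul 4).mul_const _) (Eventually.of_forall fun y => ?_)
  refine (Complex.norm_exp_mul_I_sub_taylor_two_le (u * y)).trans_eq ?_
  rw [abs_mul]
  ring

/-- Equality in the triangle inequality would make `exp (iuy)` almost surely constant, confining `y`
to a translate of `(2π / u)ℤ`, a countable and hence null set. -/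
theorem norm_charFun_lt_one {μ : Measure ℝ} [IsProbabilityMeasure μ] [NullSingletonClass μ] {u : ℝ}
    (hu : u ≠ 0) : ‖charFun μ u‖ < 1 := by
  have hb : ∀ᵐ y : ℝ ∂μ, ‖Complex.exp (u * y * Complex.I)‖ ≤ 1 := Eventually.of_forall fun y => by
    rw [← Complex.ofReal_mul, Complex.norm_exp_ofReal_mul_I]
  rcases ae_eq_const_or_norm_integral_lt_of_norm_le_const hb with h | h
  · exfalso
    set a := ⨍ y : ℝ, Complex.exp (u * y * Complex.I) ∂μ with ha
    have hcount : {y : ℝ | Complex.exp (u * y * Complex.I) = a}.Countable := by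
      rcases Set.eq_empty_or_nonempty {y : ℝ | Complex.exp (u * y * Complex.I) = a} with he | ⟨y₀, hy₀⟩
      · rw [he]; exact Set.countable_empty
      · refine (Set.countable_range fun k : ℤ => y₀ + k * (2 * Real.pi) / u).mono fun y hy => ?_
        have hy' : Complex.exp (u * y * Complex.I) = Complex.exp (u * y₀ * Complex.I) :=
          Eq.trans hy (Eq.symm hy₀)
        obtain ⟨k, hk⟩ := Complex.exp_eq_exp_iff_exists_int.1 hy'
        refine ⟨k, ?_⟩
        have h1 : ((u * y : ℝ) : ℂ) = ((u * y₀ + k * (2 * Real.pi) : ℝ) : ℂ) := by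
          apply mul_right_cancel₀ Complex.I_ne_zero
          push_cast
          linear_combination hk
        have h2 := Complex.ofReal_injective h1
        simp only
        field_simp
        linarith
    have hz : μ {y : ℝ | Complex.exp (u * y * Complex.I) = a} = 0 := hcount.measure_zero μ
    have h1 : ∀ᵐ y ∂μ, False := by
      filter_upwards [h, measure_eq_zero_iff_ae_notMem.1 hz] with y hy hy'
      exact hy' hy
    exact IsProbabilityMeasure.ne_zero μ (by simpa using h1)
  · rw [charFun_apply_real]
    simpa using h

theorem tendsto_charFun_cocompact_of_density {ν : Measure ℝ} {w : ℝ → ℝ}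
    (hw : IsContinuousDensity ν w) : Tendsto (charFun ν) (cocompact ℝ) (𝓝 0) := by
  have h := Real.zero_at_infty_fourier fun x : ℝ => (w x : ℂ)
  have hne : (-(2 * Real.pi))⁻¹ ≠ 0 := inv_ne_zero (neg_ne_zero.2 Real.two_pi_pos.ne')
  have h2 := h.comp (Homeomorph.mulLeft₀ _ hne).isClosedEmbedding.tendsto_cocompact
  refine h2.congr fun t => ?_
  simp only [Function.comp_apply, Homeomorph.coe_mulLeft₀]
  rw [← charFun_withDensity_eq_fourier hw.continuous.measurable hw.nonneg, ← hw.eq_withDensity,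
    mul_inv_cancel_left₀ (neg_ne_zero.2 Real.two_pi_pos.ne')]

/-- Riemann–Lebesgue gives the bound `1 / 2` outside a compact set; on the rest of `δ ≤ |u|` the
maximum is attained and is below `1`. -/
theorem exists_norm_charFun_le_of_density {ν : Measure ℝ} [IsProbabilityMeasure ν] {w : ℝ → ℝ}
    (hw : IsContinuousDensity ν w) {δ : ℝ} (hδ : 0 < δ) :
    ∃ q, 0 < q ∧ q < 1 ∧ ∀ u : ℝ, δ ≤ |u| → ‖charFun ν u‖ ≤ q := by
  have : NullSingletonClass ν := by rw [hw.eq_withDensity]; infer_instance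
  have hlim := (tendsto_charFun_cocompact_of_density hw).norm
  rw [norm_zero] at hlim
  obtain ⟨K, hK, hKc⟩ := mem_cocompact.1 (hlim.eventually_le_const (by norm_num : (0 : ℝ) < 1 / 2))
  have hS : IsCompact (K ∩ {u : ℝ | δ ≤ |u|}) :=
    hK.inter_right (isClosed_le continuous_const continuous_abs)
  have houter (u : ℝ) (hu : u ∉ K) : ‖charFun ν u‖ ≤ 1 / 2 := hKc hu
  rcases Set.eq_empty_or_nonempty (K ∩ {u : ℝ | δ ≤ |u|}) with he | hne
  · refine ⟨1 / 2, by norm_num, by norm_num, fun u hu => houter u fun huK => ?_⟩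
    exact Set.eq_empty_iff_forall_notMem.1 he u ⟨huK, hu⟩
  · obtain ⟨u₀, hu₀, hmax⟩ := hS.exists_isMaxOn hne
      (continuous_charFun (μ := ν)).norm.continuousOn
    have hu₀' : u₀ ≠ 0 := fun h => by
      have := hu₀.2
      rw [h] at this
      simp at this
      linarith
    refine ⟨max (1 / 2) ‖charFun ν u₀‖, by positivity,
      max_lt (by norm_num) (norm_charFun_lt_one hu₀'), fun u hu => ?_⟩
    by_cases huK : u ∈ K
    · exact (hmax ⟨huK, hu⟩).trans (le_max_right _ _)
    · exact (houter u huK).trans (le_max_left _ _)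

/-- Only the `m₀`-fold sum is known to have a density; taking roots carries its gap back to a single
site. -/
theorem exists_le_of_pow_le {α : Type*} {s : Set α} {g : α → ℝ} (hg : ∀ a, 0 ≤ g a) {m : ℕ}
    (hm : m ≠ 0) (h : ∃ q, 0 < q ∧ q < 1 ∧ ∀ a ∈ s, g a ^ m ≤ q) :
    ∃ q, 0 < q ∧ q < 1 ∧ ∀ a ∈ s, g a ≤ q := by
  obtain ⟨q, h0, h1, hq⟩ := h
  have hm' : (0 : ℝ) < (m : ℝ)⁻¹ := by positivity
  refine ⟨q ^ (m : ℝ)⁻¹, by positivity, Real.rpow_lt_one h0.le h1 hm', fun a ha => ?_⟩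
  rw [← Real.pow_rpow_inv_natCast (hg a) hm]
  exact Real.rpow_le_rpow (by have := hg a; positivity) (hq a ha) hm'.le

theorem integrable_abs_pow_three_mul_exp {b : ℝ} (hb : 0 < b) :
    Integrable fun u : ℝ => |u| ^ 3 * Real.exp (-b * u ^ 2) := by
  have h := (integrable_rpow_mul_exp_neg_mul_sq hb (s := 3) (by norm_num)).norm
  refine h.congr (Eventually.of_forall fun u => ?_)
  simp only [norm_mul, Real.norm_eq_abs, Real.abs_exp]
  congr 1
  rw [show (3 : ℝ) = ((3 : ℕ) : ℝ) by norm_num, Real.rpow_natCast, abs_pow]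

theorem integral_abs_pow_three_mul_exp_scale (b : ℝ) {s : ℝ} (hs : 0 < s) :
    ∫ u : ℝ, |u| ^ 3 * Real.exp (-(b * s) * u ^ 2) =
      (s ^ 2)⁻¹ * ∫ u : ℝ, |u| ^ 3 * Real.exp (-b * u ^ 2) := by
  have hr : 0 < √s := Real.sqrt_pos.2 hs
  have h := Measure.integral_comp_mul_left (fun u : ℝ => |u| ^ 3 * Real.exp (-b * u ^ 2)) √s
  have e (u : ℝ) : |√s * u| ^ 3 * Real.exp (-b * (√s * u) ^ 2) =
      √s ^ 3 * (|u| ^ 3 * Real.exp (-(b * s) * u ^ 2)) := by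
    rw [abs_mul, abs_of_pos hr, mul_pow, mul_pow, Real.sq_sqrt hs.le]
    ring_nf
  simp only [e, integral_const_mul] at h
  rw [abs_of_pos (by positivity), smul_eq_mul] at h
  have h4 : s ^ 2 = √s * √s ^ 3 := by
    rw [← pow_succ', show 3 + 1 = 2 * 2 by norm_num, pow_mul, Real.sq_sqrt hs.le]
  rw [h4, mul_inv, mul_comm (√s)⁻¹, mul_assoc, ← h, inv_mul_cancel_left₀ (by positivity)]

end LocalLimit

/-! ### Comparison with the Gaussian in `L¹`. -/

section IntegralEstimate

open Filter
open scoped Topology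

theorem norm_pow_sub_pow_le_mul {a b : ℂ} {M : ℝ} (ha : ‖a‖ ≤ M) (hb : ‖b‖ ≤ M) (k : ℕ) :
    ‖a ^ (k + 1) - b ^ (k + 1)‖ ≤ (k + 1) * (‖a - b‖ * M ^ k) := by
  have hM : 0 ≤ M := (norm_nonneg a).trans ha
  induction k with
  | zero => simp
  | succ k ih =>
    have e : a ^ (k + 1 + 1) - b ^ (k + 1 + 1) =
        a * (a ^ (k + 1) - b ^ (k + 1)) + (a - b) * b ^ (k + 1) := by ring
    calc _ ≤ ‖a‖ * ‖a ^ (k + 1) - b ^ (k + 1)‖ + ‖a - b‖ * ‖b‖ ^ (k + 1) := by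
          rw [e, ← norm_pow, ← norm_mul, ← norm_mul]
          exact norm_add_le _ _
      _ ≤ M * ((k + 1) * (‖a - b‖ * M ^ k)) + ‖a - b‖ * M ^ (k + 1) := by gcongr
      _ = _ := by push_cast; ring

theorem exists_local_gaussian_bounds {ψ : ℝ → ℂ} {v ρ : ℝ} (hv : 0 < v) (hρ : 0 ≤ ρ)
    (h : ∀ u : ℝ, ‖ψ u - ((1 - v * u ^ 2 / 2 : ℝ) : ℂ)‖ ≤ 4 * ρ * |u| ^ 3) :
    ∃ δ A : ℝ, 0 < δ ∧ δ ≤ 1 ∧ 0 ≤ A ∧ ∀ u : ℝ, |u| ≤ δ →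
      ‖ψ u - (Real.exp (-(v / 2) * u ^ 2) : ℂ)‖ ≤ A * |u| ^ 3 ∧
      ‖ψ u‖ ≤ Real.exp (-(v / 4) * u ^ 2) := by
  -- The bound `1 / (1 + v)` gives `t = v u² / 2 ≤ 1`, whence `|exp (-t) - 1 + t| ≤ t² ≤ (v² / 4)
  -- |u|³`; the bound `v / (16ρ + 1)` makes the cubic error at most `v u² / 4`, half of the
  -- quadratic term.
  refine ⟨min 1 (min (1 / (1 + v)) (v / (16 * ρ + 1))), 4 * ρ + v ^ 2 / 4, by positivity,
    min_le_left _ _, by positivity, fun u hu => ?_⟩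
  have h1 : |u| ≤ 1 := hu.trans (min_le_left _ _)
  have h2 : |u| * (1 + v) ≤ 1 :=
    (le_div_iff₀ (by positivity)).1 (hu.trans ((min_le_right _ _).trans (min_le_left _ _)))
  have h3 : |u| * (16 * ρ + 1) ≤ v :=
    (le_div_iff₀ (by positivity)).1 (hu.trans ((min_le_right _ _).trans (min_le_right _ _)))
  have hu0 := abs_nonneg u
  have hsq : u ^ 2 = |u| ^ 2 := (sq_abs u).symm
  have hvu : v * |u| ≤ 1 := by nlinarith
  have ht : v * u ^ 2 / 2 ≤ 1 := by
    rw [hsq]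
    nlinarith
  have ht0 : 0 ≤ v * u ^ 2 / 2 := by positivity
  have hφ := h u
  constructor
  · have he := Real.abs_exp_sub_one_sub_id_le (x := -(v * u ^ 2 / 2))
      (by rw [abs_neg, abs_of_nonneg ht0]; exact ht)
    have hcast : ‖((1 - v * u ^ 2 / 2 : ℝ) : ℂ) - (Real.exp (-(v / 2) * u ^ 2) : ℂ)‖ =
        |Real.exp (-(v * u ^ 2 / 2)) - 1 - -(v * u ^ 2 / 2)| := by
      rw [← Complex.ofReal_sub, Complex.norm_real, Real.norm_eq_abs, abs_sub_comm]
      ring_nf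
    have h4 : (-(v * u ^ 2 / 2)) ^ 2 ≤ v ^ 2 / 4 * |u| ^ 3 := by
      rw [hsq]
      have : v ^ 2 / 4 * |u| ^ 3 * |u| ≤ v ^ 2 / 4 * |u| ^ 3 * 1 :=
        mul_le_mul_of_nonneg_left h1 (by positivity)
      nlinarith
    have h5 := norm_sub_le_norm_sub_add_norm_sub (ψ u) ((1 - v * u ^ 2 / 2 : ℝ) : ℂ)
      (Real.exp (-(v / 2) * u ^ 2) : ℂ)
    rw [hcast] at h5
    linarith
  · have h4 : ‖((1 - v * u ^ 2 / 2 : ℝ) : ℂ)‖ = 1 - v * u ^ 2 / 2 := by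
      rw [Complex.norm_real, Real.norm_eq_abs, abs_of_nonneg (by linarith)]
    have h5 : ‖ψ u‖ ≤ ‖ψ u - ((1 - v * u ^ 2 / 2 : ℝ) : ℂ)‖ + ‖((1 - v * u ^ 2 / 2 : ℝ) : ℂ)‖ :=
      norm_le_norm_sub_add _ _
    have h6 : 4 * ρ * |u| ^ 3 ≤ v / 4 * u ^ 2 := by
      rw [hsq]
      have : 16 * ρ * |u| ≤ v := by nlinarith
      nlinarith [mul_le_mul_of_nonneg_right this (sq_nonneg |u|)]
    have h7 := Real.add_one_le_exp (-(v / 4) * u ^ 2)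
    linarith

/-- A vanishing second moment would concentrate `μ` at `0` and make its characteristic function
identically `1`. -/
theorem second_moment_pos {μ : Measure ℝ} [IsProbabilityMeasure μ]
    (h2 : Integrable (fun y : ℝ => y ^ 2) μ) {u : ℝ} (hu : ‖charFun μ u‖ < 1) :
    0 < ∫ y, y ^ 2 ∂μ := by
  have h0 : 0 ≤ ∫ y, y ^ 2 ∂μ := integral_nonneg fun y => sq_nonneg y
  refine h0.lt_of_ne fun h => ?_
  have h' := (integral_eq_zero_iff_of_nonneg (fun y => sq_nonneg y) h2).1 h.symm
  have : charFun μ u = 1 := by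
    rw [charFun_apply_real, integral_congr_ae (g := fun _ => (1 : ℂ))]
    · simp
    · filter_upwards [h'] with y hy
      have : y = 0 := by simpa using hy
      simp [this]
  rw [this] at hu
  simp at hu

theorem exists_natCast_mul_pow_le {q : ℝ} (h0 : 0 ≤ q) (h1 : q < 1) :
    ∃ Q, ∀ m : ℕ, m * q ^ m ≤ Q := by
  obtain ⟨Q, hQ⟩ := (tendsto_self_mul_const_pow_of_lt_one h0 h1).bddAbove_range
  exact ⟨Q, fun m => hQ ⟨m, rfl⟩⟩

/-- Powers of a characteristic function that is bounded away from `1` off the origin are close in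
`L¹` to the Gaussian with the same variance. -/
theorem exists_integral_norm_charFun_pow_sub_gaussian_le {μ : Measure ℝ} [IsProbabilityMeasure μ]
    (h3 : Integrable (fun y : ℝ => |y| ^ 3) μ) (h0 : ∫ y, y ∂μ = 0) {m₀ : ℕ} (hm₀ : m₀ ≠ 0)
    (hinteg : Integrable fun u : ℝ => ‖charFun μ u‖ ^ m₀)
    (hgap : ∀ δ > 0, ∃ q, 0 < q ∧ q < 1 ∧ ∀ u : ℝ, δ ≤ |u| → ‖charFun μ u‖ ≤ q) :
    ∃ v K : ℝ, 0 < v ∧ 0 < K ∧ ∀ m : ℕ, m₀ ≤ m →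
      Integrable (fun u : ℝ => charFun μ u ^ m - (Real.exp (-(v / 2 * m) * u ^ 2) : ℂ)) ∧
      ∫ u : ℝ, ‖charFun μ u ^ m - (Real.exp (-(v / 2 * m) * u ^ 2) : ℂ)‖ ≤ K / m := by
  have hcont : Continuous (charFun μ) := continuous_charFun
  set v := ∫ y, y ^ 2 ∂μ with hvdef
  have hv : 0 < v := by
    obtain ⟨q, -, hq1, hq⟩ := hgap 1 one_pos
    exact second_moment_pos (integrable_pow_of_integrable_abs_pow_three h3 (by norm_num))
      ((hq 1 (by simp)).trans_lt hq1)
  obtain ⟨δ, A, hδ, hδ1, hA, hloc⟩ := exists_local_gaussian_bounds hv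
    (integral_nonneg fun y => by positivity) (norm_charFun_sub_taylor_two_le h3 h0)
  obtain ⟨q, hq0, hq1, hq⟩ := hgap δ hδ
  obtain ⟨Q, hQ⟩ := exists_natCast_mul_pow_le hq0.le hq1
  set B := A * Real.exp (v / 4) + (δ ^ 3)⁻¹ with hB
  set J := ∫ u : ℝ, |u| ^ 3 * Real.exp (-(v / 4) * u ^ 2) with hJ
  set I := ∫ u : ℝ, ‖charFun μ u‖ ^ m₀ with hI
  have hJ0 : 0 ≤ J := integral_nonneg fun u => by positivity
  have hI0 : 0 ≤ I := integral_nonneg fun u => by positivity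
  have hQ0 : 0 ≤ Q := by simpa using hQ 0
  refine ⟨v, B * J + (q ^ m₀)⁻¹ * Q * I + 1, hv, by positivity, fun m hm => ?_⟩
  have hmpos : 0 < m := (Nat.pos_of_ne_zero hm₀).trans_le hm
  have hmR : (0 : ℝ) < m := by exact_mod_cast hmpos
  have hm1 : (1 : ℝ) ≤ m := by exact_mod_cast hmpos
  have hpt (u : ℝ) : ‖charFun μ u ^ m - (Real.exp (-(v / 2 * m) * u ^ 2) : ℂ)‖ ≤
      B * m * (|u| ^ 3 * Real.exp (-(v / 4 * m) * u ^ 2)) +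
        (q ^ m₀)⁻¹ * q ^ m * ‖charFun μ u‖ ^ m₀ := by
    rcases le_total |u| δ with hu | hu
    · obtain ⟨k, rfl⟩ := Nat.exists_eq_add_of_lt hmpos
      rw [zero_add] at *
      obtain ⟨hl1, hl2⟩ := hloc u hu
      have hexp : (Real.exp (-(v / 2 * (k + 1 : ℕ)) * u ^ 2) : ℂ) =
          (Real.exp (-(v / 2) * u ^ 2) : ℂ) ^ (k + 1) := by
        rw [← Complex.ofReal_pow, ← Real.exp_nat_mul]
        ring_nf
      have hg : ‖(Real.exp (-(v / 2) * u ^ 2) : ℂ)‖ ≤ Real.exp (-(v / 4) * u ^ 2) := by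
        rw [Complex.norm_real, Real.norm_eq_abs, Real.abs_exp, Real.exp_le_exp]
        nlinarith [sq_nonneg u]
      -- Telescoping leaves `m - 1` factors; restoring the missing one costs `exp (v u² / 4) ≤ exp
      -- (v / 4)`.
      have hM : Real.exp (-(v / 4) * u ^ 2) ^ k ≤
          Real.exp (v / 4) * Real.exp (-(v / 4 * (k + 1 : ℕ)) * u ^ 2) := by
        rw [← Real.exp_nat_mul, ← Real.exp_add, Real.exp_le_exp]
        have : u ^ 2 ≤ 1 := by
          rw [← sq_abs]
          exact pow_le_one₀ (abs_nonneg u) (hu.trans hδ1)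
        push_cast
        nlinarith
      have hδ3 : 0 ≤ (δ ^ 3)⁻¹ := by positivity
      rw [hexp]
      calc _ ≤ ((k : ℝ) + 1) * (‖charFun μ u - (Real.exp (-(v / 2) * u ^ 2) : ℂ)‖ *
            Real.exp (-(v / 4) * u ^ 2) ^ k) := norm_pow_sub_pow_le_mul hl2 hg k
        _ ≤ ((k : ℝ) + 1) * ((A * |u| ^ 3) *
            (Real.exp (v / 4) * Real.exp (-(v / 4 * (k + 1 : ℕ)) * u ^ 2))) := by gcongr
        _ = A * Real.exp (v / 4) * (k + 1 : ℕ) *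
            (|u| ^ 3 * Real.exp (-(v / 4 * (k + 1 : ℕ)) * u ^ 2)) := by push_cast; ring
        _ ≤ B * (k + 1 : ℕ) * (|u| ^ 3 * Real.exp (-(v / 4 * (k + 1 : ℕ)) * u ^ 2)) := by
            gcongr
            rw [hB]
            linarith
        _ ≤ _ := le_add_of_nonneg_right (by positivity)
    -- Away from `0`, `m₀` factors are kept for integrability and the others are at most `q`. The
    -- Gaussian is absorbed into the cubic term through `1 ≤ |u|³ / δ³`.
    · have h1 : ‖charFun μ u ^ m‖ ≤ (q ^ m₀)⁻¹ * q ^ m * ‖charFun μ u‖ ^ m₀ := by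
        obtain ⟨k, rfl⟩ := Nat.exists_eq_add_of_le hm
        rw [norm_pow, pow_add, pow_add, inv_mul_cancel_left₀ (by positivity), mul_comm]
        gcongr
        exact hq u hu
      have h2 : ‖(Real.exp (-(v / 2 * m) * u ^ 2) : ℂ)‖ ≤
          B * m * (|u| ^ 3 * Real.exp (-(v / 4 * m) * u ^ 2)) := by
        rw [Complex.norm_real, Real.norm_eq_abs, Real.abs_exp]
        have e1 : Real.exp (-(v / 2 * m) * u ^ 2) ≤ Real.exp (-(v / 4 * m) * u ^ 2) := by
          rw [Real.exp_le_exp]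
          have : 0 ≤ v * m * u ^ 2 := by positivity
          linarith
        have e2 : 1 ≤ (δ ^ 3)⁻¹ * |u| ^ 3 := by
          rw [inv_mul_eq_div, one_le_div (by positivity)]
          gcongr
        have e3 : (δ ^ 3)⁻¹ ≤ B := by
          rw [hB]
          have : 0 ≤ A * Real.exp (v / 4) := by positivity
          linarith
        calc _ ≤ 1 * Real.exp (-(v / 4 * m) * u ^ 2) := by rwa [one_mul]
          _ ≤ ((δ ^ 3)⁻¹ * |u| ^ 3) * Real.exp (-(v / 4 * m) * u ^ 2) := by gcongr
          _ = (δ ^ 3)⁻¹ * 1 * (|u| ^ 3 * Real.exp (-(v / 4 * m) * u ^ 2)) := by ring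
          _ ≤ B * m * (|u| ^ 3 * Real.exp (-(v / 4 * m) * u ^ 2)) := by gcongr
      have := norm_sub_le (charFun μ u ^ m) (Real.exp (-(v / 2 * m) * u ^ 2) : ℂ)
      linarith
  have hi1 := (integrable_abs_pow_three_mul_exp (b := v / 4 * m) (by positivity)).const_mul (B * m)
  have hi2 := hinteg.const_mul ((q ^ m₀)⁻¹ * q ^ m)
  refine ⟨(hi1.add hi2).mono' (by fun_prop) (Eventually.of_forall hpt), ?_⟩
  calc _ ≤ ∫ u : ℝ, (B * m * (|u| ^ 3 * Real.exp (-(v / 4 * m) * u ^ 2)) +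
        (q ^ m₀)⁻¹ * q ^ m * ‖charFun μ u‖ ^ m₀) :=
        integral_mono_of_nonneg (Eventually.of_forall fun u => norm_nonneg _) (hi1.add hi2)
          (Eventually.of_forall hpt)
    -- The cubic moment scales like `m⁻²`, so the factor `m` from telescoping leaves order `1 / m`.
    _ = B * m * (((m : ℝ) ^ 2)⁻¹ * J) + (q ^ m₀)⁻¹ * q ^ m * I := by
        rw [integral_add hi1 hi2, integral_const_mul, integral_const_mul,
          integral_abs_pow_three_mul_exp_scale _ hmR]
    _ = (B * J + (q ^ m₀)⁻¹ * (m * q ^ m) * I) / m := by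
        field_simp
    _ ≤ (B * J + (q ^ m₀)⁻¹ * Q * I) / m := by
        gcongr
        exact hQ m
    _ ≤ _ := div_le_div_of_nonneg_right (le_add_of_nonneg_right zero_le_one) hmR.le

end IntegralEstimate

/-! ### Density bounds and their quotient. -/

section DensityRatio

open Filter
open scoped Topology

theorem integrable_charFun_of_eq_pow {ν η : Measure ℝ} [IsProbabilityMeasure ν] {m : ℕ}
    (h : ∀ u, charFun η u = charFun ν u ^ m) (hinteg : Integrable fun u : ℝ => ‖charFun ν u‖ ^ m) :
    Integrable (charFun η) := by
  rw [funext h]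
  have hcont : Continuous (charFun ν) := continuous_charFun
  exact hinteg.mono' (by fun_prop) (Eventually.of_forall fun u => (norm_pow _ _).le)

theorem norm_charFun_map_add_const (ν : Measure ℝ) (a u : ℝ) :
    ‖charFun (ν.map (· + a)) u‖ = ‖charFun ν u‖ := by
  rw [charFun_map_add_const, norm_mul, Complex.norm_exp_ofReal_mul_I, mul_one]

theorem charFunDensity_le (ν : Measure ℝ) (x : ℝ) :
    2 * Real.pi * charFunDensity ν x ≤ ∫ u, ‖charFun ν u‖ := by
  have h := congrArg norm (ofReal_charFunDensity_eq_integral ν x)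
  rw [Complex.norm_real, norm_mul, Complex.norm_real, Real.norm_of_nonneg (by positivity :
    0 ≤ (2 * Real.pi)⁻¹), inv_mul_eq_div, eq_div_iff (by positivity)] at h
  calc 2 * Real.pi * charFunDensity ν x ≤ ‖charFunDensity ν x‖ * (2 * Real.pi) := by
        rw [mul_comm]
        gcongr
        exact Real.le_norm_self _
    _ = _ := h
    _ ≤ ∫ u : ℝ, ‖Complex.exp (-(u * x * Complex.I)) * charFun ν u‖ :=
        norm_integral_le_integral_norm _
    _ = _ := by
        congr with u
        rw [norm_mul, show -((u : ℂ) * x * Complex.I) = ((-(u * x) : ℝ) : ℂ) * Complex.I by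
          push_cast; ring, Complex.norm_exp_ofReal_mul_I, one_mul]

/-- Non-asymptotic bounds of local limit type for the densities of sums of independent variables
with law `ν`: an upper bound that is uniform in space, and a lower bound at the mean. -/
theorem exists_density_bounds {ν : Measure ℝ} [IsProbabilityMeasure ν] {L : ℕ → Measure ℝ}
    [∀ n, IsProbabilityMeasure (L n)] (hL : ∀ n u, charFun (L n) u = charFun ν u ^ n) {a : ℝ}
    (ha : ∫ y, y ∂ν = a) (h3 : Integrable (fun y : ℝ => |y - a| ^ 3) ν) {m₀ : ℕ} (hm₀ : m₀ ≠ 0)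
    (hinteg : Integrable fun u : ℝ => ‖charFun ν u‖ ^ m₀) :
    ∃ S C : ℝ, 0 < S ∧ 0 < C ∧ ∀ m : ℕ, m₀ ≤ m →
      (∀ z, 2 * Real.pi * charFunDensity (L m) z ≤ S / √(m : ℝ) * (1 + C / √(m : ℝ))) ∧
      S / √(m : ℝ) * (1 - C / √(m : ℝ)) ≤ 2 * Real.pi * charFunDensity (L m) (m * a) := by
  -- Centring multiplies the characteristic function by a phase, so its norm is unchanged.
  set μ := ν.map (· + -a) with hμ
  have hmeas : Measurable fun y : ℝ => y + -a := by fun_prop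
  have : IsProbabilityMeasure μ := Measure.isProbabilityMeasure_map hmeas.aemeasurable
  have hnorm (u : ℝ) : ‖charFun μ u‖ = ‖charFun ν u‖ := norm_charFun_map_add_const ν (-a) u
  have hμ3 : Integrable (fun y : ℝ => |y| ^ 3) μ := by
    rw [hμ, integrable_map_measure (by fun_prop) hmeas.aemeasurable]
    exact h3
  have hid : Integrable (fun y : ℝ => y) ν := by
    have h1 : Integrable (fun y : ℝ => y ^ 1) μ :=
      integrable_pow_of_integrable_abs_pow_three hμ3 (by norm_num)
    rw [hμ, integrable_map_measure (by fun_prop) hmeas.aemeasurable] at h1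
    refine (h1.add (integrable_const a)).congr (Eventually.of_forall fun y => ?_)
    simp
  have hμ0 : ∫ y, y ∂μ = 0 := by
    rw [hμ, integral_map hmeas.aemeasurable (by fun_prop), integral_add hid (integrable_const _), ha]
    simp
  have hdens := isContinuousDensity_charFunDensity (L m₀)
    (integrable_charFun_of_eq_pow (hL m₀) hinteg)
  have hgap (δ : ℝ) (hδ : δ > 0) :
      ∃ q, 0 < q ∧ q < 1 ∧ ∀ u : ℝ, δ ≤ |u| → ‖charFun μ u‖ ≤ q := by
    refine exists_le_of_pow_le (s := {u : ℝ | δ ≤ |u|}) (fun u => norm_nonneg (charFun μ u)) hm₀ ?_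
    simpa only [hL, norm_pow, ← hnorm] using! exists_norm_charFun_le_of_density hdens hδ
  obtain ⟨v, K, hv, hK, hmain⟩ := exists_integral_norm_charFun_pow_sub_gaussian_le hμ3 hμ0 hm₀
    (by simpa only [hnorm] using hinteg) hgap
  set S := √(Real.pi / (v / 2)) with hS
  have hS0 : 0 < S := Real.sqrt_pos.2 (by positivity)
  -- `S` is the integral of `exp (-v u² / 2)`; with `C = K / S` the error `K / m` becomes `(S / √m)
  -- (C / √m)`.
  refine ⟨S, K / S, hS0, by positivity, fun m hm => ?_⟩
  obtain ⟨hi, hle⟩ := hmain m hm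
  have hmR : (0 : ℝ) < m := by exact_mod_cast (Nat.pos_of_ne_zero hm₀).trans_le hm
  have hsm : 0 < √(m : ℝ) := Real.sqrt_pos.2 hmR
  have hgauss : ∫ u : ℝ, Real.exp (-(v / 2 * m) * u ^ 2) = S / √(m : ℝ) := by
    rw [integral_gaussian, hS, ← Real.sqrt_div (by positivity), div_div]
  have hgi : Integrable fun u : ℝ => Real.exp (-(v / 2 * m) * u ^ 2) :=
    integrable_exp_neg_mul_sq (by positivity)
  have hKm : K / m = S / √(m : ℝ) * (K / S / √(m : ℝ)) := by
    conv_lhs => rw [← Real.mul_self_sqrt hmR.le]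
    field_simp
  constructor
  · intro z
    refine (charFunDensity_le (L m) z).trans ?_
    calc ∫ u, ‖charFun (L m) u‖ ≤ ∫ u : ℝ,
          (‖charFun μ u ^ m - (Real.exp (-(v / 2 * m) * u ^ 2) : ℂ)‖ +
            Real.exp (-(v / 2 * m) * u ^ 2)) := by
          refine integral_mono_of_nonneg (Eventually.of_forall fun u => norm_nonneg _)
            (hi.norm.add hgi) (Eventually.of_forall fun u => ?_)
          have h1 := norm_le_norm_sub_add (charFun μ u ^ m)
            (Real.exp (-(v / 2 * m) * u ^ 2) : ℂ)
          rw [Complex.norm_real, Real.norm_eq_abs, Real.abs_exp] at h1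
          simp only [hL, norm_pow, ← hnorm] at h1 ⊢
          exact h1
      _ ≤ K / m + S / √(m : ℝ) := by
          rw [integral_add hi.norm hgi, hgauss]
          gcongr
      _ = _ := by rw [hKm]; ring
  -- At `m * a` the inversion phase is exactly the one that centres all `m` summands.
  · have hform : ((2 * Real.pi * charFunDensity (L m) (m * a) : ℝ) : ℂ) =
        ∫ u, charFun μ u ^ m := by
      have h2pi : (2 * (Real.pi : ℂ)) ≠ 0 := by exact_mod_cast Real.two_pi_pos.ne'
      rw [Complex.ofReal_mul, ofReal_charFunDensity_eq_integral]
      push_cast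
      rw [mul_inv_cancel_left₀ h2pi]
      congr with u
      rw [hL, hμ, charFun_map_add_const, mul_pow, ← Complex.exp_nat_mul, mul_comm]
      congr 2
      simp
      ring
    have hdiff : ((2 * Real.pi * charFunDensity (L m) (m * a) - S / √(m : ℝ) : ℝ) : ℂ) =
        ∫ u, (charFun μ u ^ m - (Real.exp (-(v / 2 * m) * u ^ 2) : ℂ)) := by
      have hgiC : Integrable fun u : ℝ => (Real.exp (-(v / 2 * m) * u ^ 2) : ℂ) := hgi.ofReal
      have hpow : Integrable fun u : ℝ => charFun μ u ^ m :=
        (hi.add hgiC).congr (Eventually.of_forall fun u => sub_add_cancel _ _)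
      rw [integral_sub hpow hgiC, integral_complex_ofReal, hgauss, ← hform]
      push_cast
      ring
    have hn := congrArg norm hdiff
    rw [Complex.norm_real, Real.norm_eq_abs] at hn
    have h1 := (hn.le.trans (norm_integral_le_integral_norm _)).trans hle
    have h2 := (abs_le.1 h1).1
    rw [hKm] at h2
    linarith

theorem log_density_ratio_le {S C m n A B : ℝ} (hS : 0 < S) (hC : 0 < C) (hm : 0 < m)
    (hmn : m ≤ n) (hCn : C < √n) (hA0 : 0 ≤ A)
    (hA : 2 * Real.pi * A ≤ S / √m * (1 + C / √m))
    (hB : S / √n * (1 - C / √n) ≤ 2 * Real.pi * B) :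
    0 < B ∧ Real.log (A / B) ≤ Real.log (n / m) + 2 / (√n / C - 1) := by
  have hn : 0 < n := hm.trans_le hmn
  set P := √m with hP
  set Q := √n with hQ
  have hP0 : 0 < P := Real.sqrt_pos.2 hm
  have hQ0 : 0 < Q := Real.sqrt_pos.2 hn
  have hPQ : P ≤ Q := Real.sqrt_le_sqrt hmn
  have hmP : m = P ^ 2 := (Real.sq_sqrt hm.le).symm
  have hnQ : n = Q ^ 2 := (Real.sq_sqrt hn.le).symm
  have hx1 : 0 < 1 - C / Q := sub_pos.2 ((div_lt_one hQ0).2 hCn)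
  have hpi := Real.two_pi_pos
  have hB0 : 0 < B := by
    have : 0 < S / Q * (1 - C / Q) := by positivity
    exact pos_of_mul_pos_right (this.trans_le hB) hpi.le
  have hexp : 0 < Q / C - 1 := sub_pos.2 ((one_lt_div hC).2 hCn)
  have hlog0 : 0 ≤ Real.log (n / m) := Real.log_nonneg ((one_le_div hm).2 hmn)
  refine ⟨hB0, ?_⟩
  -- Here `Real.log 0 = 0` stands in for `-∞`, so the case `A = 0` needs the right-hand side to be
  -- nonnegative.
  rcases hA0.eq_or_lt with h0 | hApos
  · rw [← h0, zero_div, Real.log_zero]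
    positivity
  have hratio : A / B ≤ n / m * ((1 + C / Q) / (1 - C / Q)) := by
    rw [div_le_iff₀ hB0, ← mul_le_mul_iff_right₀ hpi]
    calc 2 * Real.pi * A ≤ S / P * (1 + C / P) := hA
      _ = S * (P + C) / P ^ 2 := by field_simp
      -- Replacing `P` by `Q` in the numerator turns the prefactor `√(n / m)` into `n / m` and
      -- leaves an error in `√n` alone.
      _ ≤ S * (Q + C) / P ^ 2 := by gcongr
      _ = n / m * ((1 + C / Q) / (1 - C / Q)) * (S / Q * (1 - C / Q)) := by
          rw [hmP, hnQ]
          have := hx1.ne'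
          have hQC : Q - C ≠ 0 := by linarith
          field_simp
      _ ≤ n / m * ((1 + C / Q) / (1 - C / Q)) * (2 * Real.pi * B) := by gcongr
      _ = _ := by ring
  calc Real.log (A / B) ≤ Real.log (n / m * ((1 + C / Q) / (1 - C / Q))) :=
        Real.log_le_log (by positivity) hratio
    _ = Real.log (n / m) + Real.log ((1 + C / Q) / (1 - C / Q)) :=
        Real.log_mul (by positivity) (by positivity)
    -- With `x = C / Q`, `log y ≤ y - 1` gives `2x / (1 - x) = 2 / (1 / x - 1)`.
    _ ≤ Real.log (n / m) + ((1 + C / Q) / (1 - C / Q) - 1) := by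
        gcongr
        exact Real.log_le_sub_one_of_pos (by positivity)
    _ = Real.log (n / m) + 2 / (Q / C - 1) := by
        congr 1
        have hQC : Q - C ≠ 0 := by linarith
        have h1 : 1 - C / Q = (Q - C) / Q := by field_simp
        have h2 : Q / C - 1 = (Q - C) / C := by field_simp
        rw [h1, h2]
        field_simp
        ring

end DensityRatio

/-! ### Assembly of the result. -/

theorem proposition2p1 (f : ℝ → EReal) (hf : Measurable f) (hf_bot : ∀ x, f x ≠ ⊥)
    (c : ℝ) (hc : 0 < c)
    (hZ_pos : partitionFunction f c ≠ 0) (hZ_fin : partitionFunction f c ≠ ∞)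
    (hmoment : Integrable (fun y : ℝ => |y - siteMean f c| ^ 3) (siteLaw f c)) :
    ∃ C : ℝ, 0 < C ∧
      ∀ r : ℝ, 1 ≤ r →
        Integrable (fun u : ℝ => ‖charFun (siteLaw f c) u‖ ^ r) →
        (∀ j : ℕ, r ≤ (j : ℝ) → ∃! w : ℝ → ℝ, IsContinuousDensity (energyLaw f c j) w) ∧
        ∀ w : ℕ → ℝ → ℝ,
          (∀ j : ℕ, r ≤ (j : ℝ) → IsContinuousDensity (energyLaw f c j) (w j)) →
          ∀ n k : ℕ, r ≤ (n : ℝ) - (k : ℝ) → C < √(n : ℝ) →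
            0 < w n (n * siteMean f c) ∧
            ∀ z : ℝ,
              Real.log (w (n - k) z / w n (n * siteMean f c)) ≤
                Real.log ((n : ℝ) / ((n : ℝ) - (k : ℝ))) + 2 / (√(n : ℝ) / C - 1) := by
  have hprob := isProbabilityMeasure_energyLaw hf hf_bot hc hZ_pos hZ_fin
  have hprob1 : IsProbabilityMeasure (siteLaw f c) := hprob 1
  have hL := charFun_energyLaw_eq_pow hf hf_bot hc hZ_pos
  have hcont : Continuous (charFun (siteLaw f c)) := continuous_charFun
  have hpow (r : ℝ) (hr : Integrable (fun u : ℝ => ‖charFun (siteLaw f c) u‖ ^ r)) (hr1 : 1 ≤ r)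
      (j : ℕ) (hj : r ≤ j) : Integrable fun u : ℝ => ‖charFun (siteLaw f c) u‖ ^ j := by
    refine hr.mono' (by fun_prop) (Filter.Eventually.of_forall fun u => ?_)
    rw [norm_pow, norm_norm, ← Real.rpow_natCast]
    exact Real.rpow_le_rpow_of_exponent_ge_of_imp (norm_nonneg _) (norm_charFun_le_one u) hj
      fun _ h => absurd h (by linarith)
  have hdens (j : ℕ) (hj : Integrable fun u : ℝ => ‖charFun (siteLaw f c) u‖ ^ j) :
      IsContinuousDensity (energyLaw f c j) (charFunDensity (energyLaw f c j)) :=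
    isContinuousDensity_charFunDensity _ (integrable_charFun_of_eq_pow (hL j) hj)
  -- The least such `m` depends only on the law of one site, and so does the resulting `C`. If there
  -- is none, no `r` is admissible and any `C` serves.
  by_cases hex : ∃ m : ℕ, m ≠ 0 ∧ Integrable fun u : ℝ => ‖charFun (siteLaw f c) u‖ ^ m
  · classical
    obtain ⟨S, C, hS, hC, hbound⟩ := exists_density_bounds hL rfl hmoment
      (Nat.find_spec hex).1 (Nat.find_spec hex).2
    refine ⟨C, hC, fun r hr hri => ⟨fun j hj => ?_, fun w hw n k hnk hn => ?_⟩⟩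
    · exact ⟨_, hdens j (hpow r hri hr j hj), fun w hw => hw.unique (hdens j (hpow r hri hr j hj))⟩
    · have hkn : k ≤ n := by
        have : (k : ℝ) ≤ n := by linarith
        exact_mod_cast this
      have hcast : ((n - k : ℕ) : ℝ) = n - k := Nat.cast_sub hkn
      have hk0 : (0 : ℝ) ≤ k := k.cast_nonneg
      have hge (j : ℕ) (hj : r ≤ j) : Nat.find hex ≤ j := by
        refine Nat.find_min' hex ⟨?_, hpow r hri hr j hj⟩
        rintro rfl
        simp only [Nat.cast_zero] at hj
        linarith
      have heq (j : ℕ) (hj : r ≤ j) : w j = charFunDensity (energyLaw f c j) :=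
        (hw j hj).unique (hdens j (hpow r hri hr j hj))
      have hrn : r ≤ n := by linarith
      have hrm : r ≤ (n - k : ℕ) := by rwa [hcast]
      have key (z : ℝ) := log_density_ratio_le (m := (n - k : ℕ)) (n := n)
        (B := w n (n * siteMean f c)) hS hC (by linarith)
        (by rw [hcast]; linarith) hn ((hw _ hrm).nonneg z)
        (by rw [heq _ hrm]; exact (hbound _ (hge _ hrm)).1 z)
        (by rw [heq _ hrn]; exact (hbound _ (hge _ hrn)).2)
      rw [hcast] at key
      exact ⟨(key 0).1, fun z => (key z).2⟩
  · refine ⟨1, one_pos, fun r hr hri => absurd ?_ hex⟩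
    obtain ⟨j, hj⟩ := exists_nat_ge r
    refine ⟨j, ?_, hpow r hri hr j hj⟩
    rintro rfl
    simp only [Nat.cast_zero] at hj
    linarith
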